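/- Let $V$ be a finite set of $n$ accounts and let $c : V\times V\to\mathbb{R}_{\ge 0}$, $c(v,v)=0$, give the capacities of a payment channel network $G$ on $V$ (the edges are the pairs of positive capacity). Let $s\neq r$ be accounts and $val\ge 0$. A feasible flow from $s$ to $r$ is a function $f:V\times V\to\mathbb{R}$ with $f(v,w)\le c(v,w)$, $f(v,w)=-f(w,v)$ and $\sum_{u}f(u,v)=0$ for $v\ne s,r$; its value is $\sum_v f(v,r)$. HushRelay is the following asynchronous distributed protocol. Add a dummy source $s'$ and a dummy sink $r'$ with edges $(s',s)$ and $(r,r')$ of capacity $val$; all other new pairs have capacity $0$. Two nodes are neighbours if there is an edge between them in some direction. Every node $v$ stores a label $d(v)\in\mathbb{N}$, an excess $e(v)$, values $f(v,w)$ for all $w$, and the last label it was told of each other node. Initially $d(s')=n+2$ and all other labels are $0$, and all nodes know this; $f(s',s)=val=-f(s,s')$, $e(s)=val=-e(s')$, and all other flows and excesses are $0$. Messages are delivered reliably after arbitrary finite delays, in the order of sending on each ordered pair of nodes. The residual capacity is $r_f(v,w)=c(v,w)-f(v,w)$, computed by $v$ from its own data. A node $v\ne s',r'$ is active if $e(v)>0$.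 An active node $v$ that is not waiting for an answer acts as follows. (Push) If some neighbour $w$ has $r_f(v,w)>0$ and, as far as $v$ knows, $d(w)<d(v)$, then $v$ chooses such a $w$, sets $\delta=\min(e(v),r_f(v,w))$, increases $f(v,w)$ by $\delta$, decreases $e(v)$ by $\delta$, sends $w$ a push request $(\delta,d(v))$ and waits for the answer. When $w$ receives the request: if $d(w)<d(v)$, it increases $e(w)$ by $\delta$, decreases $f(w,v)$ by $\delta$ and answers "accepted"; otherwise it answers NAK with its label $d(w)$. On receiving the NAK, $v$ undoes its two changes and records $d(w)$; either answer ends the waiting. (Relabel) If there is no such $w$, then $v$ sets $d(v)$ to $1$ plus the minimum of the labels, as far as $v$ knows them, of the neighbours $w$ with $r_f(v,w)>0$, and sends the new label to all its neighbours, who record it on receipt. The protocol has terminated when no node is active and no node is waiting for an answer. Claim: if $val$ is at most the maximum value of a feasible flow from $s$ to $r$ in $G$, then HushRelay routes the whole payment from $s$ to $r$. That is, whatever the order in which the nodes act and the messages are delivered, every execution is finite, it can stop only when the protocol has terminated, and on termination the values $f(v,w)$ stored by the accounts $v\in V$, for $w\in V$, form a feasible flow from $s$ to $r$ in $G$ of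 value $val$, and $e(r')=val$. -/

import Mathlib

/-! ### Payment channel networks as flow networks -/

/-- A payment channel network on the accounts `V`, as a flow network.  `cap v w` is the amount that
`v` can transfer to `w` over their channel.  The directed edges are the pairs of positive capacity;
a channel joins two different accounts. -/
structure PCN (V : Type*) where
  cap : V → V → ℝ
  cap_nonneg : ∀ v w, 0 ≤ cap v w
  cap_self : ∀ v, cap v v = 0

namespace PCN

variable {V : Type*} [Fintype V]

/-- `f` is a feasible flow from `s` to `r`. -/
structure IsFlow (G : PCN V) (s r : V) (f : V → V → ℝ) : Prop where
  capacity : ∀ v w, f v w ≤ G.cap v w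
  antisymm : ∀ v w, f v w = -f w v
  conservation : ∀ v, v ≠ s → v ≠ r → ∑ u, f u v = 0

/-- The values of the feasible flows from `s` to `r`; the value of a flow is the net flow into
the sink. -/
def flowValues (G : PCN V) (s r : V) : Set ℝ :=
  {F | ∃ f : V → V → ℝ, G.IsFlow s r f ∧ ∑ v, f v r = F}

theorem flowValues_nonempty (G : PCN V) (s r : V) : (G.flowValues s r).Nonempty :=
  ⟨0, fun _ _ => 0, ⟨G.cap_nonneg, by simp, by simp⟩, by simp⟩

theorem flowValues_bddAbove (G : PCN V) (s r : V) : BddAbove (G.flowValues s r) := by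
  refine ⟨∑ v, G.cap v r, ?_⟩
  rintro F ⟨f, hf, rfl⟩
  exact Finset.sum_le_sum fun v _ => hf.capacity v r

/-- The maximum flow value from `s` to `r` (the set is nonempty and bounded above). -/
noncomputable def maxFlow (G : PCN V) (s r : V) : ℝ := sSup (G.flowValues s r)

end PCN

/-! ### The asynchronous push-relabel protocol HushRelay -/

namespace HushRelay

/-- The nodes running the protocol: the accounts, the dummy source `s'` and the dummy sink `r'`. -/
inductive Node (V : Type*) where
  | account (v : V)
  | dummySource
  | dummySink
  deriving DecidableEq, Fintype

/-- The messages exchanged by neighbouring nodes.  In `request δ d` the sender asks to push `δ` and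
`d` is its label; `accept δ d` and `nak δ d` answer a request for `δ` and `d` is the label of the
answering node; `newLabel d` announces the sender's new label. -/
inductive Msg where
  | request (δ : ℝ) (d : ℕ)
  | accept (δ : ℝ) (d : ℕ)
  | nak (δ : ℝ) (d : ℕ)
  | newLabel (d : ℕ)

/-- What a node `v` stores: its distance label `d(v)`, its excess `e(v)`, its value `f(v,w)` of the
preflow on the pair `(v,w)`, the label of `w` as far as `v` has been told, and whether `v` is
waiting for the answer to a push request. -/
structure LocalState (V : Type*) where
  label : ℕ
  excess : ℝ
  flow : Node V → ℝ
  known : Node V → ℕ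
  waiting : Bool

/-- A global configuration: the local states, and for every ordered pair `(u, v)` of nodes the
first-in-first-out queue of the messages under way from `u` to `v` (oldest first). -/
structure Config (V : Type*) where
  node : Node V → LocalState V
  chan : Node V → Node V → List Msg

variable {V : Type*} [DecidableEq V]

/-- The capacities after the virtual edges `(s', s)` and `(r, r')` of capacity `val` are added. -/
noncomputable def augCap (G : PCN V) (s r : V) (val : ℝ) : Node V → Node V → ℝ
  | .account v, .account w => G.cap v w
  | .dummySource, .account v => if v = s then val else 0
  | .account v, .dummySink => if v = r then val else 0
  | _, _ => 0

/-- Two nodes are neighbours if there is an edge between them, in either direction. -/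
abbrev Nbr (c : Node V → Node V → ℝ) (v w : Node V) : Prop := 0 < c v w ∨ 0 < c w v

/-- The residual capacity of `(v,w)`, as `v` computes it from its own local state `x`. -/
def resCap (c : Node V → Node V → ℝ) (v : Node V) (x : LocalState V) (w : Node V) : ℝ :=
  c v w - x.flow w

/-- `w` is a neighbour to which `v`, in local state `x`, has positive residual capacity. -/
def ResNbr (c : Node V → Node V → ℝ) (v : Node V) (x : LocalState V) (w : Node V) : Prop :=
  Nbr c v w ∧ 0 < resCap c v x w

/-- A node is active if it is not a dummy node and has positive excess. -/
def Active (v : Node V) (x : LocalState V) : Prop :=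
  v ≠ .dummySource ∧ v ≠ .dummySink ∧ 0 < x.excess

/-- The outgoing messages `m` to `w` and nothing to any other node. -/
def sendTo (w : Node V) (m : Msg) : Node V → List Msg :=
  fun u => if u = w then [m] else []

/-- The steps which an active node `v` that is not waiting for an answer takes on its own:
`Internal c v x y out` says that `v` can go from local state `x` to local state `y`, sending the
messages `out u` to each node `u`. -/
inductive Internal (c : Node V → Node V → ℝ) (v : Node V) (x : LocalState V) :
    LocalState V → (Node V → List Msg) → Prop
  /-- Push: `v` chooses a neighbour `w` with positive residual capacity and, as far as `v` knows,
  a smaller label; it books the push of `δ = min (e(v)) (r_f(v,w))`, sends the request to `w` and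
  waits for the answer. -/
  | push (w : Node V) (δ : ℝ) (hactive : Active v x) (hidle : x.waiting = false)
      (hw : ResNbr c v x w) (hlabel : x.known w < x.label)
      (hδ : δ = min x.excess (resCap c v x w)) :
      Internal c v x
        { x with
          excess := x.excess - δ
          flow := Function.update x.flow w (x.flow w + δ)
          waiting := true }
        (sendTo w (.request δ x.label))
  /-- Relabel: if no neighbour with positive residual capacity has, as far as `v` knows, a smaller
  label, then `v` raises its label to `1` plus the minimum of their labels and tells all its
  neighbours. -/
  | relabel (k : ℕ) (hactive : Active v x) (hidle : x.waiting = false)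
      (hmin : IsLeast {d | ∃ w, ResNbr c v x w ∧ x.known w = d} k) (hlabel : x.label ≤ k) :
      Internal c v x { x with label := k + 1 }
        (fun u => if Nbr c v u then [.newLabel (k + 1)] else [])

/-- The reaction of a node in local state `x` to a message from `u`: its new local state and the
messages it sends. -/
noncomputable def receive (x : LocalState V) (u : Node V) :
    Msg → LocalState V × (Node V → List Msg)
  | .request δ d =>
      if x.label < d then
        ({ x with
            excess := x.excess + δ
            flow := Function.update x.flow u (x.flow u - δ) },
          sendTo u (.accept δ x.label))
      else (x, sendTo u (.nak δ x.label))
  | .accept _ _ => ({ x with waiting := false }, fun _ => [])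
  | .nak δ d =>
      ({ x with
          excess := x.excess + δ
          flow := Function.update x.flow u (x.flow u - δ)
          known := Function.update x.known u d
          waiting := false },
        fun _ => [])
  | .newLabel d => ({ x with known := Function.update x.known u d }, fun _ => [])

/-- Node `v` gets the local state `y` and its messages `out` are appended to its queues. -/
def Config.emit (C : Config V) (v : Node V) (y : LocalState V) (out : Node V → List Msg) :
    Config V where
  node := Function.update C.node v y
  chan a b := if a = v then C.chan a b ++ out b else C.chan a b

/-- The queue from `u` to `v` is replaced by `q`. -/
def Config.setQueue (C : Config V) (u v : Node V) (q : List Msg) : Config V where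
  node := C.node
  chan a b := if a = u ∧ b = v then q else C.chan a b

/-- One step of the asynchronous network: some node acts on its own, or the oldest message of some
queue is delivered. -/
inductive Step (c : Node V → Node V → ℝ) : Config V → Config V → Prop
  | act (C : Config V) (v : Node V) (y : LocalState V) (out : Node V → List Msg)
      (h : Internal c v (C.node v) y out) : Step c C (C.emit v y out)
  | deliver (C : Config V) (u v : Node V) (m : Msg) (q : List Msg) (h : C.chan u v = m :: q) :
      Step c C ((C.setQueue u v q).emit v
        (receive (C.node v) u m).1 (receive (C.node v) u m).2)

/-- The initial labels: `n + 2` for the dummy source, `0` for every other node. -/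
def initLabel [Fintype V] : Node V → ℕ
  | .dummySource => Fintype.card V + 2
  | _ => 0

/-- The initial preflow: `val` on `(s', s)`, hence `-val` on `(s, s')`, and `0` elsewhere. -/
noncomputable def initFlow (s : V) (val : ℝ) : Node V → Node V → ℝ
  | .dummySource, .account v => if v = s then val else 0
  | .account v, .dummySource => if v = s then -val else 0
  | _, _ => 0

/-- The initial excess: `val` at `s`, hence `-val` at `s'`, and `0` elsewhere. -/
noncomputable def initExcess (s : V) (val : ℝ) : Node V → ℝ
  | .account v => if v = s then val else 0
  | .dummySource => -val
  | .dummySink => 0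

/-- The initial configuration for the payment of `val` by `s`: no message is under way, and the
initial labels are known. -/
noncomputable def init [Fintype V] (s : V) (val : ℝ) : Config V where
  node v :=
    { label := initLabel v
      excess := initExcess s val v
      flow := initFlow s val v
      known := initLabel
      waiting := false }
  chan _ _ := []

/-- `C` occurs in some execution of the protocol for the payment request `(s, r, val)`. -/
def Reachable [Fintype V] (G : PCN V) (s r : V) (val : ℝ) (C : Config V) : Prop :=
  Relation.ReflTransGen (Step (augCap G s r val)) (init s val) C

/-- The protocol has terminated: no node is active and no push request is still under way or
unanswered. -/
def Terminated (C : Config V) : Prop :=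
  ∀ v, ¬ Active v (C.node v) ∧ (C.node v).waiting = false

/-- The flow on the original network that the accounts have stored. -/
def routedFlow (C : Config V) (v w : V) : ℝ := (C.node (.account v)).flow (.account w)

end HushRelay

/-! A push under way is booked by its sender only. Hence `f(a,b) + f(b,a)` is not zero but equals
the amount recorded by the messages between `a` and `b`, so it is nonnegative, while each excess is
still minus the sum of the node's own flow values. Labels stay valid (a residual arc descends by at
most one) although nodes act on outdated labels. Labels only grow and queues are first-in-first-out,
so recorded labels are lower bounds and a relabel never overshoots. A residual arc is opened only by
an acceptance or a received NAK, and then it leads to a node with at least the same label. `Inv`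
collects these facts and `Inv.step` preserves them.

The other main tool is a gap in the labels: `n` accounts cannot fill `n + 1` consecutive values. If
no node has label `k`, no residual arc leaves the set of nodes above `k`, so the total excess of
this set is at most minus the capacity of its cut (`Inv.sum_excess_le`). A gap above `n + 2` shows
that a node with positive excess has label at most `2n + 3`. A gap between `1` and `n + 1` separates
`s'` from `r'`. On termination only `s'` has nonzero excess on its side, and every such cut has
capacity at least `val` (`val_le_cut`), so `val` has reached `r'`. Only the easy half of max-flow
min-cut duality is needed.

Executions are finite because a lexicographic `rank` falls at every step: the room left for label
increases, the number of neighbours taken to be lower, the number of stalled requests and NAKs, and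
a weighted potential of residual arcs, active nodes and messages. -/

namespace HushRelay

variable {V : Type*}

/-! ### Messages: booked amounts and label information -/

/-- The amount of a push that the sender of the request has booked and its receiver has not, and
that is recorded by the message. -/
def Msg.booked : Msg → ℝ
  | .request δ _ => δ
  | .nak δ _ => δ
  | _ => 0

/-- A node that has recorded the label `k` of the sender records `k'` on receipt of `m`; labels do
not decrease and a request carries the label known so far. -/
def Msg.Relays (k : ℕ) (m : Msg) (k' : ℕ) : Prop :=
  match m with
  | .request _ d => d = k ∧ k' = k
  | .accept _ _ => k' = k
  | .nak _ d => k ≤ d ∧ k' = d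
  | .newLabel d => k ≤ d ∧ k' = d

theorem Msg.Relays.le {k k' : ℕ} {m : Msg} (h : m.Relays k k') : k ≤ k' := by
  cases m <;> simp only [Msg.Relays] at h <;> omega

/-- The messages of the queue `q` lead from the recorded label `k` to the label `D`. -/
def Sync : ℕ → List Msg → ℕ → Prop
  | k, [], D => k = D
  | k, m :: q, D => ∃ k', m.Relays k k' ∧ Sync k' q D

theorem Sync.le {k D : ℕ} {q : List Msg} (h : Sync k q D) : k ≤ D := by
  induction q generalizing k with
  | nil => exact le_of_eq h
  | cons m q ih =>
    obtain ⟨k', hm, hq⟩ := h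
    exact hm.le.trans (ih hq)

theorem Sync.concat {k D D' : ℕ} {q : List Msg} {m : Msg} (h : Sync k q D)
    (hm : m.Relays D D') : Sync k (q ++ [m]) D' := by
  induction q generalizing k with
  | nil => cases h; exact ⟨D', hm, rfl⟩
  | cons m q ih =>
    obtain ⟨k', hm', hq⟩ := h
    exact ⟨k', hm', ih hq⟩

/-! ### Effect of one delivery on states and queues -/

section Receive

variable [DecidableEq V]

@[simp] theorem receive_label (x : LocalState V) (u : Node V) (m : Msg) :
    (receive x u m).1.label = x.label := by
  cases m <;> simp only [receive]
  split_ifs <;> rfl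

theorem receive_known_of_ne (x : LocalState V) {u w : Node V} (m : Msg) (h : w ≠ u) :
    (receive x u m).1.known w = x.known w := by
  cases m <;> simp only [receive, Function.update_of_ne h]
  split_ifs <;> rfl

theorem receive_known_self (x : LocalState V) (u : Node V) {m : Msg} {k : ℕ}
    (h : m.Relays (x.known u) k) : (receive x u m).1.known u = k := by
  cases m <;> simp only [receive, Msg.Relays] at h ⊢
  · split_ifs <;> exact h.2.symm
  · exact h.symm
  · simp [h.2]
  · simp [h.2]

theorem mem_receive_out {x : LocalState V} {u b : Node V} {m m' : Msg}
    (h : m' ∈ (receive x u m).2 b) :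
    b = u ∧ ∃ δ d, m = .request δ d ∧
      ((x.label < d ∧ m' = .accept δ x.label) ∨ (d ≤ x.label ∧ m' = .nak δ x.label)) := by
  cases m with
  | request δ d =>
    simp only [receive] at h
    split_ifs at h with hl <;> simp only [sendTo] at h <;> split_ifs at h <;> simp_all
  | _ => simp [receive] at h

@[simp] theorem emit_node (C : Config V) (v a : Node V) (y : LocalState V)
    (out : Node V → List Msg) :
    (C.emit v y out).node a = if a = v then y else C.node a := by
  simp [Config.emit, Function.update_apply]

@[simp] theorem emit_chan (C : Config V) (v a b : Node V) (y : LocalState V)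
    (out : Node V → List Msg) :
    (C.emit v y out).chan a b = if a = v then C.chan a b ++ out b else C.chan a b := rfl

@[simp] theorem setQueue_node (C : Config V) (u v : Node V) (q : List Msg) :
    (C.setQueue u v q).node = C.node := rfl

@[simp] theorem setQueue_chan (C : Config V) (u v a b : Node V) (q : List Msg) :
    (C.setQueue u v q).chan a b = if a = u ∧ b = v then q else C.chan a b := rfl

/-- The configuration after the oldest message `m` from `u` to `v` is delivered and `q` remains. -/
noncomputable abbrev Config.deliver (C : Config V) (u v : Node V) (m : Msg) (q : List Msg) :
    Config V :=
  (C.setQueue u v q).emit v (receive (C.node v) u m).1 (receive (C.node v) u m).2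

theorem mem_chan_deliver {C : Config V} {u v a b : Node V} {m m' : Msg} {q : List Msg}
    (hq : C.chan u v = m :: q) (h : m' ∈ (C.deliver u v m q).chan a b) :
    m' ∈ C.chan a b ∨ (a = v ∧ b = u ∧ ∃ δ d, m = .request δ d ∧
      (((C.node v).label < d ∧ m' = .accept δ (C.node v).label) ∨
        (d ≤ (C.node v).label ∧ m' = .nak δ (C.node v).label))) := by
  have hsub : m' ∈ (if a = u ∧ b = v then q else C.chan a b) → m' ∈ C.chan a b := by
    split_ifs with hab
    · rintro h
      rw [hab.1, hab.2, hq]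
      exact List.mem_cons_of_mem _ h
    · exact id
  simp only [emit_chan, setQueue_chan] at h
  by_cases hav : a = v
  · rw [if_pos hav, List.mem_append] at h
    rcases h with h | h
    · exact .inl (hsub h)
    · exact .inr ⟨hav, mem_receive_out h⟩
  · rw [if_neg hav] at h
    exact .inl (hsub h)

end Receive

/-! ### Sums over nodes and over messages under way -/

section Sums

variable [DecidableEq V] [Fintype V] {M : Type*} [AddCommMonoid M]

/-- The sum of a weight over all messages under way. -/
def msgSum (wt : Node V → Node V → Msg → M) (C : Config V) : M :=
  ∑ a, ∑ b, ((C.chan a b).map (wt a b)).sum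

/-- The sum of a weight over the local states of all nodes. -/
def nodeSum (F : Node V → LocalState V → M) (C : Config V) : M := ∑ a, F a (C.node a)

/-- The old and new terms stand on opposite sides because the sums are used in `ℕ`, without
subtraction. -/
theorem nodeSum_emit (F : Node V → LocalState V → M) (C : Config V) (v : Node V)
    (y : LocalState V) (out : Node V → List Msg) :
    nodeSum F (C.emit v y out) + F v (C.node v) = nodeSum F C + F v y := by
  simp only [nodeSum]
  rw [← Finset.add_sum_erase _ _ (Finset.mem_univ v),
    ← Finset.add_sum_erase (a := v) Finset.univ (fun a => F a (C.node a)) (Finset.mem_univ v)]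
  have : ∑ x ∈ Finset.univ.erase v, F x ((C.emit v y out).node x)
      = ∑ x ∈ Finset.univ.erase v, F x (C.node x) :=
    Finset.sum_congr rfl fun x hx => by simp [Finset.ne_of_mem_erase hx]
  rw [this, emit_node, if_pos rfl]
  ac_rfl

theorem msgSum_emit (wt : Node V → Node V → Msg → M) (C : Config V) (v : Node V)
    (y : LocalState V) (out : Node V → List Msg) :
    msgSum wt (C.emit v y out) = msgSum wt C + ∑ b, ((out b).map (wt v b)).sum := by
  have : ∀ a b, (((C.emit v y out).chan a b).map (wt a b)).sum
      = ((C.chan a b).map (wt a b)).sum + if a = v then ((out b).map (wt v b)).sum else 0 := by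
    intro a b
    rw [emit_chan]
    split_ifs with h
    · simp [h]
    · simp
  simp only [msgSum, this, Finset.sum_add_distrib]
  congr 1
  rw [Finset.sum_comm]
  simp

theorem msgSum_setQueue (wt : Node V → Node V → Msg → M) {C : Config V} {u v : Node V} {m : Msg}
    {q : List Msg} (hq : C.chan u v = m :: q) :
    msgSum wt (C.setQueue u v q) + wt u v m = msgSum wt C := by
  have : ∀ a b, ((C.chan a b).map (wt a b)).sum
      = (((C.setQueue u v q).chan a b).map (wt a b)).sum
        + if a = u then (if b = v then wt u v m else 0) else 0 := by
    intro a b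
    rw [setQueue_chan]
    by_cases ha : a = u
    · by_cases hb : b = v
      · simp [ha, hb, hq, add_comm]
      · simp [ha, hb]
    · simp [ha]
  simp only [msgSum, this, Finset.sum_add_distrib]
  congr 1
  rw [Finset.sum_comm]
  simp

theorem sum_map_sendTo (wt : Node V → Msg → M) (w : Node V) (m : Msg) :
    ∑ b, ((sendTo w m b).map (wt b)).sum = wt w m := by
  have : ∀ b, ((sendTo w m b).map (wt b)).sum = if b = w then wt w m else 0 := by
    intro b
    simp only [sendTo]
    split_ifs with h <;> simp [h]
  simp [this]

theorem msgSum_deliver (wt : Node V → Node V → Msg → M) {C : Config V} {u v : Node V} {m : Msg}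
    {q : List Msg} (hq : C.chan u v = m :: q) :
    msgSum wt (C.deliver u v m q) + wt u v m =
      msgSum wt C + ∑ b, (((receive (C.node v) u m).2 b).map (wt v b)).sum := by
  rw [Config.deliver, msgSum_emit, ← msgSum_setQueue wt hq]
  ac_rfl

theorem nodeSum_deliver (F : Node V → LocalState V → M) (C : Config V) (u v : Node V) (m : Msg)
    (q : List Msg) :
    nodeSum F (C.deliver u v m q) + F v (C.node v) =
      nodeSum F C + F v (receive (C.node v) u m).1 :=
  nodeSum_emit F (C.setQueue u v q) v _ _

omit [DecidableEq V] in
theorem msgSum_eq_zero {wt : Node V → Node V → Msg → ℕ} {C : Config V} (h : msgSum wt C = 0)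
    {a b : Node V} {m : Msg} (hm : m ∈ C.chan a b) : wt a b m = 0 := by
  simp only [msgSum, Finset.sum_eq_zero_iff, Finset.mem_univ, true_imp_iff,
    List.sum_eq_zero_iff, List.mem_map, forall_exists_index, and_imp] at h
  exact h a b _ m hm rfl

end Sums

/-! ### The invariant -/

/-- `1` for the requests of `v` and the answers to `v`. -/
def pendingWt [DecidableEq V] (v a b : Node V) : Msg → ℕ
  | .request _ _ => if a = v then 1 else 0
  | .accept _ _ => if b = v then 1 else 0
  | .nak _ _ => if b = v then 1 else 0
  | .newLabel _ => 0

/-- The total amount booked by the messages of a queue. -/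
def bookedSum (q : List Msg) : ℝ := (q.map Msg.booked).sum

@[simp] theorem bookedSum_nil : bookedSum [] = 0 := rfl

@[simp] theorem bookedSum_cons (m : Msg) (q : List Msg) :
    bookedSum (m :: q) = m.booked + bookedSum q := by simp [bookedSum]

@[simp] theorem bookedSum_append (q q' : List Msg) :
    bookedSum (q ++ q') = bookedSum q + bookedSum q' := by simp [bookedSum]

section Invariant

variable [DecidableEq V] [Fintype V]

/-- The invariant of the protocol on a network with capacities `c`. -/
structure Inv (c : Node V → Node V → ℝ) (C : Config V) : Prop where
  nbr : ∀ a b, ∀ m ∈ C.chan a b, Nbr c a b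
  booked_nonneg : ∀ a b, ∀ m ∈ C.chan a b, 0 ≤ m.booked
  -- A waiting node cannot relabel, so the label in its request stays current.
  request_label : ∀ a b δ d, Msg.request δ d ∈ C.chan a b → d = (C.node a).label
  nak_label : ∀ a b δ d, Msg.nak δ d ∈ C.chan a b → (C.node b).label ≤ d
  sync : ∀ a b, Nbr c a b → Sync ((C.node b).known a) (C.chan a b) (C.node a).label
  pending : ∀ v, msgSum (pendingWt v) C = if (C.node v).waiting then 1 else 0
  pair : ∀ a b, (C.node a).flow b + (C.node b).flow a
    = bookedSum (C.chan a b) + bookedSum (C.chan b a)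
  excess_eq : ∀ a, (C.node a).excess = -∑ b, (C.node a).flow b
  excess_nonneg : ∀ a, a ≠ .dummySource → 0 ≤ (C.node a).excess
  capacity : ∀ a b, (C.node a).flow b ≤ c a b
  valid : ∀ a b, (C.node a).flow b < c a b → (C.node a).label ≤ (C.node b).label + 1
  label_source : (C.node .dummySource).label = Fintype.card V + 2
  label_sink : (C.node .dummySink).label = 0

end Invariant

/-! ### Preservation under pushes and relabels -/

section Preservation

variable {V : Type*} [DecidableEq V] [Fintype V] {c : Node V → Node V → ℝ} {C : Config V}

namespace Inv

omit [DecidableEq V] in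
theorem bookedSum_nonneg_of_mem {q : List Msg} (h : ∀ m ∈ q, 0 ≤ m.booked) : 0 ≤ bookedSum q :=
  List.sum_nonneg fun x hx => by
    obtain ⟨m, hm, rfl⟩ := List.mem_map.1 hx
    exact h m hm

theorem pair_nonneg (hC : Inv c C) (a b : Node V) :
    0 ≤ (C.node a).flow b + (C.node b).flow a := by
  rw [hC.pair]
  exact add_nonneg (bookedSum_nonneg_of_mem (hC.booked_nonneg a b))
    (bookedSum_nonneg_of_mem (hC.booked_nonneg b a))

/-- Both values on the pair are at most the capacity `0`, and their sum is nonnegative. -/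
theorem flow_eq_zero (hc : ∀ a b, 0 ≤ c a b) (hC : Inv c C) {a b : Node V} (h : ¬ Nbr c a b) :
    (C.node a).flow b = 0 := by
  have hp := hC.pair_nonneg a b
  have h1 := hC.capacity a b
  have h2 := hC.capacity b a
  simp only [Nbr, not_or, not_lt] at h
  have := hc a b
  have := hc b a
  linarith

theorem nbr_of_lt (hc : ∀ a b, 0 ≤ c a b) (hC : Inv c C) {a b : Node V}
    (h : (C.node a).flow b < c a b) : Nbr c a b := by
  by_contra hn
  rw [hC.flow_eq_zero hc hn] at h
  exact hn (.inl h)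

theorem pendingWt_eq_zero (hC : Inv c C) {v : Node V} (hv : (C.node v).waiting = false)
    {a b : Node V} {m : Msg} (hm : m ∈ C.chan a b) : pendingWt v a b m = 0 :=
  msgSum_eq_zero (by rw [hC.pending, hv]; rfl) hm

theorem known_le (hC : Inv c C) {a b : Node V} (h : Nbr c a b) :
    (C.node b).known a ≤ (C.node a).label := (hC.sync a b h).le

/-- The booked `δ` enters the queue together with the request, which balances `pair`. Flow only
increases, so no residual arc appears and validity is not at risk. -/
theorem emit_push (hirr : ∀ a, c a a = 0) (hC : Inv c C) {v w : Node V} {δ : ℝ}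
    (hactive : Active v (C.node v)) (hidle : (C.node v).waiting = false)
    (hw : ResNbr c v (C.node v) w) (hδ : δ = min (C.node v).excess (resCap c v (C.node v) w)) :
    Inv c (C.emit v
      { C.node v with
        excess := (C.node v).excess - δ
        flow := Function.update (C.node v).flow w ((C.node v).flow w + δ)
        waiting := true }
      (sendTo w (.request δ (C.node v).label))) := by
  have hvw : v ≠ w := by
    rintro rfl
    have := hw.1
    simp [Nbr, hirr] at this
  have hδ0 : 0 ≤ δ := hδ ▸ le_min hactive.2.2.le hw.2.le
  have hδe : δ ≤ (C.node v).excess := hδ ▸ min_le_left _ _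
  have hδr : δ ≤ c v w - (C.node v).flow w := hδ ▸ min_le_right _ _
  have hmem : ∀ a b m, m ∈ (if a = v then C.chan a b ++ sendTo w (.request δ (C.node v).label) b
      else C.chan a b) → m ∈ C.chan a b ∨ (a = v ∧ b = w ∧ m = .request δ (C.node v).label) := by
    intro a b m hm
    split_ifs at hm with ha
    · rw [List.mem_append] at hm
      refine hm.imp id fun h => ⟨ha, ?_⟩
      simp only [sendTo] at h
      split_ifs at h with hb
      · exact ⟨hb, by simpa using h⟩
      · simp at h
    · exact .inl hm
  have hlabel : ∀ a, (if a = v then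
      { C.node v with
        excess := (C.node v).excess - δ
        flow := Function.update (C.node v).flow w ((C.node v).flow w + δ)
        waiting := true } else C.node a).label = (C.node a).label := by
    intro a; split_ifs with h <;> simp [h]
  have hknown : ∀ a, (if a = v then
      { C.node v with
        excess := (C.node v).excess - δ
        flow := Function.update (C.node v).flow w ((C.node v).flow w + δ)
        waiting := true } else C.node a).known = (C.node a).known := by
    intro a; split_ifs with h <;> simp [h]
  have hflow : ∀ a b, (if a = v then
      { C.node v with
        excess := (C.node v).excess - δ
        flow := Function.update (C.node v).flow w ((C.node v).flow w + δ)
        waiting := true } else C.node a).flow b =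
        (C.node a).flow b + if a = v ∧ b = w then δ else 0 := by
    intro a b
    by_cases ha : a = v
    · by_cases hb : b = w <;> simp [ha, hb]
    · simp [ha]
  constructor
  case nbr =>
    intro a b m hm
    rcases hmem a b m hm with h | ⟨rfl, rfl, -⟩
    · exact hC.nbr a b m h
    · exact hw.1
  case booked_nonneg =>
    intro a b m hm
    rcases hmem a b m hm with h | ⟨rfl, rfl, rfl⟩
    · exact hC.booked_nonneg a b m h
    · exact hδ0
  case request_label =>
    intro a b δ' d hm
    rw [emit_node, hlabel]
    rcases hmem a b _ hm with h | ⟨rfl, rfl, h⟩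
    · exact hC.request_label a b δ' d h
    · cases h; rfl
  case nak_label =>
    intro a b δ' d hm
    rw [emit_node, hlabel]
    rcases hmem a b _ hm with h | ⟨rfl, rfl, h⟩
    · exact hC.nak_label a b δ' d h
    · cases h
  case sync =>
    intro a b hab
    rw [emit_node, emit_node, hlabel, hknown, emit_chan]
    have := hC.sync a b hab
    by_cases ha : a = v
    · by_cases hb : b = w
      · rw [if_pos ha, sendTo, if_pos hb]
        exact this.concat ⟨by rw [ha], rfl⟩
      · simpa [ha, hb, sendTo] using ha ▸ this
    · simpa [ha] using this
  case pending =>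
    intro z
    rw [msgSum_emit, sum_map_sendTo, hC.pending, emit_node]
    by_cases hz : z = v
    · simp [hz, hidle, pendingWt]
    · simp [hz, Ne.symm hz, pendingWt]
  case pair =>
    intro a b
    rw [emit_node, emit_node, hflow, hflow, emit_chan, emit_chan]
    have := hC.pair a b
    by_cases h1 : a = v ∧ b = w
    · obtain ⟨rfl, rfl⟩ := h1
      simp [hvw.symm, sendTo, Msg.booked]
      linarith
    · by_cases h2 : b = v ∧ a = w
      · obtain ⟨rfl, rfl⟩ := h2
        simp [hvw.symm, sendTo, Msg.booked]
        linarith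
      · rw [if_neg h1, if_neg h2]
        have e1 : (if a = v then C.chan a b ++ sendTo w (.request δ (C.node v).label) b
            else C.chan a b) = C.chan a b := by
          by_cases ha : a = v
          · have hb : b ≠ w := fun h => h1 ⟨ha, h⟩
            simp [sendTo, ha, hb]
          · simp [ha]
        have e2 : (if b = v then C.chan b a ++ sendTo w (.request δ (C.node v).label) a
            else C.chan b a) = C.chan b a := by
          by_cases ha : b = v
          · have hb : a ≠ w := fun h => h2 ⟨ha, h⟩
            simp [sendTo, ha, hb]
          · simp [ha]
        rw [e1, e2]
        linarith
  case excess_eq =>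
    intro a
    simp only [emit_node, hflow, Finset.sum_add_distrib]
    have := hC.excess_eq a
    by_cases ha : a = v
    · subst ha
      simp
      linarith
    · simpa [ha] using this
  case excess_nonneg =>
    intro a ha
    rw [emit_node]
    split_ifs
    · exact sub_nonneg.2 hδe
    · exact hC.excess_nonneg a ha
  case capacity =>
    intro a b
    rw [emit_node, hflow]
    split_ifs with h
    · rw [h.1, h.2]; linarith
    · simpa using hC.capacity a b
  case valid =>
    intro a b h
    rw [emit_node, hflow] at h
    rw [emit_node, emit_node, hlabel, hlabel]
    refine hC.valid a b (lt_of_le_of_lt ?_ h)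
    split_ifs <;> linarith
  case label_source => rw [emit_node, hlabel]; exact hC.label_source
  case label_sink => rw [emit_node, hlabel]; exact hC.label_sink

theorem emit_relabel (hc : ∀ a b, 0 ≤ c a b) (hirr : ∀ a, c a a = 0) (hC : Inv c C) {v : Node V}
    {k : ℕ} (hactive : Active v (C.node v)) (hidle : (C.node v).waiting = false)
    (hmin : IsLeast {d | ∃ w, ResNbr c v (C.node v) w ∧ (C.node v).known w = d} k)
    (hlabel : (C.node v).label ≤ k) :
    Inv c (C.emit v { C.node v with label := k + 1 }
      (fun u => if Nbr c v u then [.newLabel (k + 1)] else [])) := by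
  have hmem : ∀ a b m, m ∈ (if a = v then C.chan a b ++
      (if Nbr c v b then [Msg.newLabel (k + 1)] else []) else C.chan a b) →
      m ∈ C.chan a b ∨ (a = v ∧ Nbr c v b ∧ m = .newLabel (k + 1)) := by
    intro a b m hm
    split_ifs at hm with ha hb
    · rw [List.mem_append] at hm
      exact hm.imp id fun h => ⟨ha, hb, by simpa using h⟩
    · exact .inl (by simpa using hm)
    · exact .inl hm
  have hstate : ∀ a, (if a = v then { C.node v with label := k + 1 } else C.node a)
      = { C.node a with label := if a = v then k + 1 else (C.node a).label } := by
    intro a; split_ifs with h <;> simp [h]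
  constructor <;> simp only [emit_node, hstate]
  case nbr =>
    intro a b m hm
    rcases hmem a b m hm with h | ⟨rfl, h, -⟩
    · exact hC.nbr a b m h
    · exact h
  case booked_nonneg =>
    intro a b m hm
    rcases hmem a b m hm with h | ⟨rfl, -, rfl⟩
    · exact hC.booked_nonneg a b m h
    · exact le_rfl
  case request_label =>
    intro a b δ d hm
    rcases hmem a b _ hm with h | ⟨-, -, h⟩
    -- The relabelled node is idle, so none of its requests is under way.
    · rw [if_neg, hC.request_label a b δ d h]
      intro ha
      simpa [pendingWt, ha] using hC.pendingWt_eq_zero hidle h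
    · cases h
  case nak_label =>
    intro a b δ d hm
    rcases hmem a b _ hm with h | ⟨-, -, h⟩
    · rw [if_neg]
      · exact hC.nak_label a b δ d h
      intro ha
      simpa [pendingWt, ha] using hC.pendingWt_eq_zero hidle h
    · cases h
  case sync =>
    intro a b hab
    have := hC.sync a b hab
    rw [emit_chan]
    by_cases ha : a = v
    · subst ha
      rw [if_pos rfl, if_pos rfl, if_pos hab]
      exact this.concat ⟨by omega, rfl⟩
    · simpa [ha] using this
  case pending =>
    intro z
    rw [msgSum_emit, hC.pending, Finset.sum_eq_zero, add_zero]
    intro b _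
    split_ifs <;> simp [pendingWt]
  case pair =>
    have : ∀ a b, bookedSum ((C.emit v { C.node v with label := k + 1 }
        (fun u => if Nbr c v u then [.newLabel (k + 1)] else [])).chan a b)
        = bookedSum (C.chan a b) := by
      intro a b
      rw [emit_chan]
      split_ifs <;> simp [Msg.booked]
    intro a b
    rw [this, this]
    exact hC.pair a b
  case excess_eq => exact hC.excess_eq
  case excess_nonneg => exact hC.excess_nonneg
  case capacity => exact hC.capacity
  case valid =>
    intro a b h
    have hv := hC.valid a b h
    by_cases ha : a = v
    · subst ha
      have hn := hC.nbr_of_lt hc h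
      have hba : b ≠ a := by
        rintro rfl
        simp [Nbr, hirr] at hn
      -- The new label is one more than a minimum of recorded labels, and a recorded label never
      -- exceeds the true one.
      have h1 := hmin.2 ⟨b, ⟨hn, sub_pos.2 h⟩, rfl⟩
      have h2 := hC.known_le hn.symm
      rw [if_pos rfl, if_neg hba]
      omega
    · rw [if_neg ha]
      split_ifs with hb
      · subst hb; omega
      · exact hv
  case label_source => rw [if_neg hactive.1.symm]; exact hC.label_source
  case label_sink => rw [if_neg hactive.2.1.symm]; exact hC.label_sink

end Inv

end Preservation

/-! ### Preservation under deliveries -/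

/-- The amount by which a node with label `l` raises its excess on receipt of a message. -/
noncomputable def Msg.taken (l : ℕ) : Msg → ℝ
  | .request δ d => if l < d then δ else 0
  | .nak δ _ => δ
  | _ => 0

theorem Msg.taken_nonneg {m : Msg} (h : 0 ≤ m.booked) (l : ℕ) : 0 ≤ m.taken l := by
  cases m <;> simp only [Msg.booked, Msg.taken] at h ⊢ <;> first | exact h | exact le_rfl | skip
  split_ifs <;> simp [h]

section Preservation

variable {V : Type*} [DecidableEq V]

theorem receive_excess (x : LocalState V) (u : Node V) (m : Msg) :
    (receive x u m).1.excess = x.excess + m.taken x.label := by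
  cases m <;> simp only [receive, Msg.taken, add_zero]
  split_ifs <;> simp

theorem receive_flow (x : LocalState V) (u b : Node V) (m : Msg) :
    (receive x u m).1.flow b = x.flow b - if b = u then m.taken x.label else 0 := by
  have hupd : ∀ δ, Function.update x.flow u (x.flow u - δ) b
      = x.flow b - if b = u then δ else 0 := by
    intro δ
    by_cases hb : b = u <;> simp [hb]
  cases m <;> simp only [receive, Msg.taken, ite_self, sub_zero]
  · split_ifs with h hb <;> simp_all
  · exact hupd _

theorem bookedSum_receive_out (x : LocalState V) (u b : Node V) (m : Msg) :
    bookedSum ((receive x u m).2 b) = if b = u then m.booked - m.taken x.label else 0 := by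
  cases m <;> simp only [receive, Msg.taken, Msg.booked, sub_self, ite_self, bookedSum_nil]
  split_ifs with h hb <;> simp_all [sendTo, Msg.booked]

theorem bookedSum_deliver {C : Config V} {u v : Node V} {m : Msg} {q : List Msg}
    (hq : C.chan u v = m :: q) (a b : Node V) :
    bookedSum ((C.deliver u v m q).chan a b) + (if a = u ∧ b = v then m.booked else 0) =
      bookedSum (C.chan a b) +
        if a = v ∧ b = u then m.booked - m.taken (C.node v).label else 0 := by
  have h1 : bookedSum ((C.setQueue u v q).chan a b) + (if a = u ∧ b = v then m.booked else 0)
      = bookedSum (C.chan a b) := by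
    rw [setQueue_chan]
    split_ifs with h
    · rw [h.1, h.2, hq, bookedSum_cons, add_comm]
    · simp
  rw [← h1, emit_chan]
  by_cases ha : a = v
  · rw [if_pos ha, bookedSum_append, bookedSum_receive_out]
    simp only [ha, true_and]
    ring
  · simp [ha]

variable [Fintype V] {c : Node V → Node V → ℝ} {C : Config V}

namespace Inv

/-- A request is replaced by its answer, which has the same weight; an answer disappears exactly
when the waiting ends. -/
theorem msgSum_pendingWt_deliver (hC : Inv c C) {u v : Node V} {m : Msg} {q : List Msg}
    (hq : C.chan u v = m :: q) (z : Node V) :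
    msgSum (pendingWt z) (C.deliver u v m q)
      = if ((C.deliver u v m q).node z).waiting then 1 else 0 := by
  have h := msgSum_deliver (pendingWt z) hq
  rw [hC.pending] at h
  rw [emit_node, setQueue_node]
  cases m with
  | request δ d =>
    have hw : (if z = v then (receive (C.node v) u (.request δ d)).1 else C.node z).waiting
        = (C.node z).waiting := by
      simp only [receive]
      split_ifs <;> simp_all
    have hs : ∑ b, (((receive (C.node v) u (.request δ d)).2 b).map (pendingWt z v b)).sum
        = pendingWt z u v (.request δ d) := by
      simp only [receive]
      split_ifs <;> (rw [sum_map_sendTo]; rfl)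
    rw [hs] at h
    rw [hw]
    exact Nat.add_right_cancel h
  | newLabel d =>
    simp only [receive, pendingWt, List.map_nil, List.sum_nil, Finset.sum_const_zero,
      add_zero] at h ⊢
    rw [h]
    split_ifs <;> simp_all
  | _ =>
    simp only [receive, pendingWt, List.map_nil, List.sum_nil, Finset.sum_const_zero,
      add_zero] at h ⊢
    by_cases hz : z = v
    · rw [if_pos hz.symm] at h
      simp only [if_pos hz]
      split_ifs at h
      all_goals simp_all
    · rw [if_neg (Ne.symm hz), add_zero] at h
      rw [h]
      simp [hz]

/-- Taking an amount is what can open the arc from `v` back to `u`, so this keeps labels valid. An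
accepted request carries the current label of `u`, which exceeds that of `v`. A NAK carries a label
at least that of `v`, and the label of `u` can only have grown since. -/
theorem label_le_of_taken_ne_zero (hC : Inv c C) {u v : Node V} {m : Msg} {q : List Msg}
    (hq : C.chan u v = m :: q) (h : m.taken (C.node v).label ≠ 0) :
    (C.node v).label ≤ (C.node u).label := by
  have hm : m ∈ C.chan u v := by simp [hq]
  cases m with
  | request δ d =>
    simp only [Msg.taken] at h
    have := hC.request_label _ _ _ _ hm
    by_contra hl
    rw [if_neg (by omega)] at h
    exact h rfl
  | nak δ d =>
    have h1 := hC.nak_label _ _ _ _ hm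
    have h2 := hC.sync u v (hC.nbr _ _ _ hm)
    rw [hq] at h2
    obtain ⟨k, ⟨-, rfl⟩, h3⟩ := h2
    exact h1.trans h3.le
  | _ => simp [Msg.taken] at h

theorem deliver (hirr : ∀ a, c a a = 0) (hC : Inv c C) {u v : Node V}
    {m : Msg} {q : List Msg} (hq : C.chan u v = m :: q) : Inv c (C.deliver u v m q) := by
  have hm : m ∈ C.chan u v := by simp [hq]
  have hnbr : Nbr c u v := hC.nbr _ _ _ hm
  have huv : u ≠ v := by
    rintro rfl
    simp [Nbr, hirr] at hnbr
  have ht := Msg.taken_nonneg (hC.booked_nonneg _ _ _ hm) (C.node v).label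
  have hlabel : ∀ a, ((C.deliver u v m q).node a).label = (C.node a).label := by
    intro a
    rw [emit_node]
    split_ifs with h <;> simp [h]
  have hflow : ∀ a b, ((C.deliver u v m q).node a).flow b =
      (C.node a).flow b - if a = v ∧ b = u then m.taken (C.node v).label else 0 := by
    intro a b
    rw [emit_node]
    by_cases h : a = v
    · rw [if_pos h, receive_flow]; simp [h]
    · simp [h]
  constructor
  case nbr =>
    intro a b m' hm'
    rcases mem_chan_deliver hq hm' with h | ⟨rfl, rfl, -⟩
    · exact hC.nbr a b m' h
    · exact hnbr.symm
  case booked_nonneg =>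
    intro a b m' hm'
    rcases mem_chan_deliver hq hm' with h | ⟨rfl, rfl, δ, d, rfl, ⟨-, rfl⟩ | ⟨-, rfl⟩⟩
    · exact hC.booked_nonneg a b m' h
    · exact le_rfl
    · have := hC.booked_nonneg _ _ _ hm
      exact this
  case request_label =>
    intro a b δ d hm'
    rw [hlabel]
    rcases mem_chan_deliver hq hm' with h | ⟨rfl, rfl, δ, d, rfl, ⟨-, h⟩ | ⟨-, h⟩⟩
    · exact hC.request_label a b δ d h
    · cases h
    · cases h
  case nak_label =>
    intro a b δ d hm'
    rw [hlabel]
    rcases mem_chan_deliver hq hm' with h | ⟨rfl, rfl, δ, d', rfl, ⟨-, h⟩ | ⟨hd, h⟩⟩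
    · exact hC.nak_label a b δ d h
    · cases h
    · cases h
      -- The refused request carried the label that the requester still has.
      rwa [← hC.request_label _ _ _ _ hm]
  case sync =>
    intro a b hab
    rw [hlabel]
    have hs := hC.sync a b hab
    by_cases h1 : a = u ∧ b = v
    · obtain ⟨rfl, rfl⟩ := h1
      rw [hq] at hs
      obtain ⟨k, hk, hs⟩ := hs
      rw [emit_node, if_pos rfl, receive_known_self _ _ hk, emit_chan, if_neg huv, setQueue_chan,
        if_pos ⟨rfl, rfl⟩]
      exact hs
    · have hknown : ((C.deliver u v m q).node b).known a = (C.node b).known a := by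
        rw [emit_node]
        by_cases hb : b = v
        · rw [if_pos hb, receive_known_of_ne _ _ fun h => h1 ⟨h, hb⟩, hb]
        · rw [if_neg hb, setQueue_node]
      rw [hknown, emit_chan, setQueue_chan, if_neg h1]
      by_cases ha : a = v
      · subst ha
        rw [if_pos rfl]
        cases m with
        | request δ d =>
          simp only [receive]
          split_ifs with hl <;> simp only [sendTo] <;> split_ifs with hb
          · exact hs.concat rfl
          · simpa using hs
          · exact hs.concat ⟨le_rfl, rfl⟩
          · simpa using hs
        | _ => simpa [receive] using hs
      · rwa [if_neg ha]
  case pending => exact hC.msgSum_pendingWt_deliver hq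
  case pair =>
    intro a b
    have h1 := bookedSum_deliver hq a b
    have h2 := bookedSum_deliver hq b a
    have h3 := hC.pair a b
    rw [hflow, hflow]
    by_cases ha : a = u ∧ b = v
    · obtain ⟨rfl, rfl⟩ := ha
      simp only [huv, huv.symm, and_self, if_true, if_false] at h1 h2 ⊢
      linarith
    · by_cases hb : a = v ∧ b = u
      · obtain ⟨rfl, rfl⟩ := hb
        simp only [huv, huv.symm, and_self, if_true, if_false] at h1 h2 ⊢
        linarith
      · rw [and_comm] at ha hb
        simp only [ha, hb, and_comm (a := a = u), and_comm (a := a = v), if_false] at h1 h2 ⊢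
        linarith
  case excess_eq =>
    intro a
    simp only [hflow, Finset.sum_sub_distrib]
    have := hC.excess_eq a
    rw [emit_node]
    by_cases ha : a = v
    · subst ha
      simp [receive_excess]
      linarith
    · simpa [ha] using this
  case excess_nonneg =>
    intro a ha
    have := hC.excess_nonneg a ha
    rw [emit_node]
    split_ifs with h
    · rw [receive_excess, ← h]
      rw [← h] at ht
      exact add_nonneg this ht
    · exact this
  case capacity =>
    intro a b
    have := hC.capacity a b
    rw [hflow]
    split_ifs <;> linarith
  case valid =>
    intro a b h
    rw [hflow] at h
    rw [hlabel, hlabel]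
    by_cases h1 : a = v ∧ b = u
    · obtain ⟨rfl, rfl⟩ := h1
      by_cases h0 : m.taken (C.node a).label = 0
      · rw [h0] at h
        exact hC.valid a b (by simpa using h)
      · exact (hC.label_le_of_taken_ne_zero hq h0).trans (Nat.le_succ _)
    · rw [if_neg h1, sub_zero] at h
      exact hC.valid a b h
  case label_source => rw [hlabel]; exact hC.label_source
  case label_sink => rw [hlabel]; exact hC.label_sink

theorem step (hc : ∀ a b, 0 ≤ c a b) (hirr : ∀ a, c a a = 0) (hC : Inv c C) {C' : Config V}
    (h : Step c C C') : Inv c C' := by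
  cases h with
  | act v y out h =>
    cases h with
    | push w δ hactive hidle hw hlabel hδ => exact hC.emit_push hirr hactive hidle hw hδ
    | relabel k hactive hidle hmin hlabel =>
      exact hC.emit_relabel hc hirr hactive hidle hmin hlabel
  | deliver u v m q hq => exact hC.deliver hirr hq

end Inv

end Preservation

/-! ### Initial configuration -/

section Termination

variable {V : Type*} [DecidableEq V] [Fintype V]

omit [DecidableEq V] in
theorem sum_node {M : Type*} [AddCommMonoid M] (F : Node V → M) :
    ∑ a, F a = ∑ v, F (.account v) + F .dummySource + F .dummySink := by
  let φ : Option (Option V) ≃ Node V :=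
    { toFun := fun
        | none => .dummySink
        | some none => .dummySource
        | some (some v) => .account v
      invFun := fun
        | .dummySink => none
        | .dummySource => some none
        | .account v => some (some v)
      left_inv := by rintro (_ | _ | _) <;> rfl
      right_inv := by rintro (_ | _ | _) <;> rfl }
  rw [← Equiv.sum_comp φ, Fintype.sum_option, Fintype.sum_option]
  simp only [φ, Equiv.coe_fn_mk]
  abel

omit [Fintype V] in
theorem augCap_nonneg (G : PCN V) (s r : V) {val : ℝ} (hval : 0 ≤ val) (a b : Node V) :
    0 ≤ augCap G s r val a b := by
  cases a <;> cases b <;> simp only [augCap] <;> first | exact G.cap_nonneg _ _ | exact le_rfl | skip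
  all_goals split_ifs <;> simp [hval]

omit [Fintype V] in
theorem augCap_self (G : PCN V) (s r : V) (val : ℝ) (a : Node V) : augCap G s r val a a = 0 := by
  cases a <;> simp [augCap, G.cap_self]

theorem inv_init (G : PCN V) (s r : V) {val : ℝ} (hval : 0 ≤ val) :
    Inv (augCap G s r val) (init s val) := by
  constructor <;> simp only [init]
  case nbr => simp
  case booked_nonneg => simp
  case request_label => simp
  case nak_label => simp
  case sync => exact fun a b _ => rfl
  case pending => simp [msgSum]
  case pair =>
    rintro (a | _ | _) (b | _ | _) <;> simp [initFlow] <;> split_ifs <;> simp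
  case excess_eq =>
    rintro (a | _ | _) <;> rw [sum_node] <;> simp [initFlow, initExcess]
    split_ifs <;> simp
  case excess_nonneg =>
    rintro (a | _ | _) h <;> simp [initExcess] at h ⊢
    split_ifs <;> simp [hval]
  case capacity =>
    rintro (a | _ | _) (b | _ | _) <;> simp [initFlow, augCap, G.cap_nonneg] <;> split_ifs <;>
      simp [hval]
  case valid =>
    -- The arc from `s'` to `s` is saturated, so the high label of `s'` violates nothing.
    rintro (a | _ | _) (b | _ | _) <;> simp [initFlow, augCap, initLabel]
  case label_source => rfl
  case label_sink => rfl

variable {c : Node V → Node V → ℝ} {C : Config V}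

/-! ### Label gaps, cuts and the bound on labels -/

namespace Inv

/-- If no residual arc leaves `S` then the total excess of `S` is at most minus the capacity
of the cut. -/
theorem sum_excess_le (hC : Inv c C) (S : Finset (Node V))
    (hS : ∀ a ∈ S, ∀ b ∉ S, ¬ (C.node a).flow b < c a b) :
    ∑ a ∈ S, (C.node a).excess ≤ -∑ a ∈ S, ∑ b ∈ Sᶜ, c a b := by
  have h1 : ∑ a ∈ S, (C.node a).excess =
      -(∑ a ∈ S, ∑ b ∈ S, (C.node a).flow b) - ∑ a ∈ S, ∑ b ∈ Sᶜ, c a b := by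
    rw [← Finset.sum_neg_distrib, ← Finset.sum_sub_distrib]
    refine Finset.sum_congr rfl fun a ha => ?_
    have : ∑ b ∈ Sᶜ, c a b = ∑ b ∈ Sᶜ, (C.node a).flow b :=
      Finset.sum_congr rfl fun b hb =>
        le_antisymm (not_lt.1 (hS a ha b (Finset.mem_compl.1 hb))) (hC.capacity a b)
    rw [hC.excess_eq, this, ← Finset.sum_add_sum_compl S]
    ring
  have h2 : 0 ≤ ∑ a ∈ S, ∑ b ∈ S, ((C.node a).flow b + (C.node b).flow a) :=
    Finset.sum_nonneg fun a _ => Finset.sum_nonneg fun b _ => hC.pair_nonneg a b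
  simp only [Finset.sum_add_distrib] at h2
  rw [Finset.sum_comm (f := fun a b => (C.node b).flow a)] at h2
  linarith

omit [DecidableEq V] in
-- Pigeonhole: `n` accounts against `n + 1` values.
theorem exists_gap (C : Config V) (l : ℕ) :
    ∃ k, l < k ∧ k ≤ l + Fintype.card V + 1 ∧ ∀ v, (C.node (.account v)).label ≠ k := by
  classical
  by_contra! h
  have hsub : Finset.Ioc l (l + Fintype.card V + 1) ⊆
      Finset.univ.image fun v => (C.node (.account v)).label := by
    intro k hk
    rw [Finset.mem_Ioc] at hk
    obtain ⟨v, hv⟩ := h k hk.1 hk.2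
    exact Finset.mem_image.2 ⟨v, Finset.mem_univ v, hv⟩
  have := (Finset.card_le_card hsub).trans Finset.card_image_le
  rw [Nat.card_Ioc, Finset.card_univ] at this
  omega

/-- A residual arc across a missing label would descend by at least two. -/
theorem closed_of_gap (hC : Inv c C) {k : ℕ} (hk : ∀ a, (C.node a).label ≠ k) :
    ∀ a ∈ Finset.univ.filter (fun a => k < (C.node a).label),
    ∀ b ∉ Finset.univ.filter (fun a => k < (C.node a).label), ¬ (C.node a).flow b < c a b := by
  intro a ha b hb h
  simp only [Finset.mem_filter, Finset.mem_univ, true_and] at ha hb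
  have := hC.valid a b h
  have := hk b
  omega

theorem label_le_of_excess_pos (hc : ∀ a b, 0 ≤ c a b) (hC : Inv c C) {a : Node V}
    (h : 0 < (C.node a).excess) :
    (C.node a).label ≤ 2 * Fintype.card V + 3 := by
  by_contra! hl
  -- Starting at the label of `s'` keeps `s'`, the only node whose excess may be negative, out of
  -- the upper set.
  obtain ⟨k, hk1, hk2, hk⟩ := exists_gap C (Fintype.card V + 2)
  have hs := hC.label_source
  have hr := hC.label_sink
  have hgap : ∀ b, (C.node b).label ≠ k := by
    rintro (v | _ | _)
    · exact hk v
    · omega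
    · omega
  have hsum := hC.sum_excess_le _ (hC.closed_of_gap hgap)
  have hcut : 0 ≤ ∑ a ∈ Finset.univ.filter (fun a => k < (C.node a).label),
      ∑ b ∈ (Finset.univ.filter (fun a => k < (C.node a).label))ᶜ, c a b :=
    Finset.sum_nonneg fun _ _ => Finset.sum_nonneg fun _ _ => hc _ _
  have hpos : 0 < ∑ a ∈ Finset.univ.filter (fun a => k < (C.node a).label),
      (C.node a).excess := by
    refine Finset.sum_pos' (fun b hb => hC.excess_nonneg b ?_) ⟨a, ?_, h⟩
    · rintro rfl
      rw [Finset.mem_filter] at hb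
      omega
    · rw [Finset.mem_filter]
      exact ⟨Finset.mem_univ _, by omega⟩
  linarith

/-- A label rises only by a relabel, which leaves the excess positive, so the bound for positive
excess applies to the new configuration. -/
theorem label_le_step (hc : ∀ a b, 0 ≤ c a b) {C' : Config V} (hC' : Inv c C')
    (h : Step c C C') (hl : ∀ a, (C.node a).label ≤ 2 * Fintype.card V + 3) (a : Node V) :
    (C'.node a).label ≤ 2 * Fintype.card V + 3 := by
  cases h with
  | act v y out h =>
    by_cases ha : a = v
    · cases h with
      | push w δ hactive hidle hw hlabel hδ => simpa [ha] using hl v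
      | relabel k hactive hidle hmin hlabel =>
        subst ha
        refine hC'.label_le_of_excess_pos hc ?_
        simpa using hactive.2.2
    · simpa [ha] using hl a
  | deliver u v m q hq =>
    rw [emit_node]
    split_ifs
    · simpa using hl v
    · exact hl a

end Inv

/-! ### The decreasing lexicographic measure -/

/-- The potential of a node: the residual arcs to nodes it takes to be lower, and its activity,
weighted by its label. -/
noncomputable def localWt (c : Node V → Node V → ℝ) (v : Node V) (x : LocalState V) : ℕ :=
  ((Finset.univ.filter fun w => x.known w < x.label ∧ x.flow w < c v w).card
    + if 0 < x.excess then 1 else 0) * (4 * 4 ^ x.label)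

/-- The potential of a message. -/
def msgWt : Msg → ℕ
  -- A push from label `d` frees at least `4 * 4 ^ d` at the sender. Its acceptance costs at most `4
  -- ^ d` at the receiver, whose label is below `d`, and `1` for the answer; `3 * 4 ^ d` lies
  -- strictly between.
  | .request _ d => 3 * 4 ^ d
  | _ => 1

/-- `1` for the requests, and the refusals of requests, of a node to another one which it no longer
takes to be lower. -/
def stalledWt (st : Node V → LocalState V) (a b : Node V) : Msg → ℕ
  | .request _ _ => if (st a).known b < (st a).label then 0 else 1
  | .nak _ _ => if (st b).known a < (st b).label then 0 else 1
  | _ => 0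

omit [DecidableEq V] [Fintype V] in
theorem stalledWt_congr {st st' : Node V → LocalState V}
    (h : ∀ a b, (st' a).known b < (st' a).label ↔ (st a).known b < (st a).label) :
    stalledWt st' = stalledWt st := by
  funext a b m
  cases m <;> simp [stalledWt, h]

/-- The room for label increases below `L`. -/
def labelRoom (L : ℕ) (C : Config V) : ℕ := nodeSum (fun _ x => L - x.label) C

/-- The number of pairs of a node and another one which it takes to be lower. -/
def lowerCount (C : Config V) : ℕ :=
  nodeSum (fun _ x => (Finset.univ.filter fun w => x.known w < x.label).card) C

/-- The number of requests and refusals under way between nodes whose sender no longer takes the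
receiver to be lower. -/
def stalledCount (C : Config V) : ℕ := msgSum (stalledWt C.node) C

/-- The potential of a configuration. -/
noncomputable def potential (c : Node V → Node V → ℝ) (C : Config V) : ℕ :=
  nodeSum (localWt c) C + msgSum (fun _ _ => msgWt) C

/-- The lexicographic measure that every step decreases. -/
noncomputable def rank (c : Node V → Node V → ℝ) (L : ℕ) (C : Config V) :
    ℕ ×ₗ ℕ ×ₗ ℕ ×ₗ ℕ :=
  toLex (labelRoom L C, toLex (lowerCount C, toLex (stalledCount C, potential c C)))

omit [DecidableEq V] in
theorem rank_lt_of_labelRoom_lt {L : ℕ} {C C' : Config V} (h : labelRoom L C' < labelRoom L C) :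
    rank c L C' < rank c L C :=
  Prod.Lex.toLex_lt_toLex.2 (.inl h)

omit [DecidableEq V] in
theorem rank_lt_of_lowerCount_lt {L : ℕ} {C C' : Config V} (h1 : labelRoom L C' = labelRoom L C)
    (h : lowerCount C' < lowerCount C) : rank c L C' < rank c L C :=
  Prod.Lex.toLex_lt_toLex.2 (.inr ⟨h1, Prod.Lex.toLex_lt_toLex.2 (.inl h)⟩)

omit [DecidableEq V] in
theorem rank_lt_of_stalledCount_lt {L : ℕ} {C C' : Config V}
    (h1 : labelRoom L C' = labelRoom L C) (h2 : lowerCount C' = lowerCount C)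
    (h : stalledCount C' < stalledCount C) : rank c L C' < rank c L C :=
  Prod.Lex.toLex_lt_toLex.2 (.inr ⟨h1, Prod.Lex.toLex_lt_toLex.2
    (.inr ⟨h2, Prod.Lex.toLex_lt_toLex.2 (.inl h)⟩)⟩)

omit [DecidableEq V] in
theorem rank_lt_of_potential_lt {L : ℕ} {C C' : Config V}
    (h1 : labelRoom L C' = labelRoom L C) (h2 : lowerCount C' = lowerCount C)
    (h3 : stalledCount C' ≤ stalledCount C)
    (h : potential c C' < potential c C) : rank c L C' < rank c L C := by
  rcases h3.lt_or_eq with h3 | h3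
  · exact rank_lt_of_stalledCount_lt h1 h2 h3
  · exact Prod.Lex.toLex_lt_toLex.2 (.inr ⟨h1, Prod.Lex.toLex_lt_toLex.2
      (.inr ⟨h2, Prod.Lex.toLex_lt_toLex.2 (.inr ⟨h3, h⟩)⟩)⟩)

/-- The push either exhausts the excess or saturates a counted arc, so the factor of the label
weight falls by at least one. -/
theorem localWt_push {v w : Node V} {x : LocalState V} {δ : ℝ} (hpos : 0 < x.excess)
    (hw : ResNbr c v x w) (hlabel : x.known w < x.label)
    (hδ : δ = min x.excess (resCap c v x w)) :
    localWt c v { x with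
        excess := x.excess - δ
        flow := Function.update x.flow w (x.flow w + δ)
        waiting := true } + 4 * 4 ^ x.label ≤ localWt c v x := by
  have hδ0 : 0 < δ := hδ ▸ lt_min hpos hw.2
  have hsub : (Finset.univ.filter fun b => x.known b < x.label ∧
      Function.update x.flow w (x.flow w + δ) b < c v b) ⊆
      Finset.univ.filter fun b => x.known b < x.label ∧ x.flow b < c v b := by
    intro b
    simp only [Finset.mem_filter, Finset.mem_univ, true_and]
    rintro ⟨h1, h2⟩
    refine ⟨h1, ?_⟩
    by_cases hb : b = w
    · subst hb
      rw [Function.update_self] at h2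
      linarith
    · rwa [Function.update_of_ne hb] at h2
  have hcount : (Finset.univ.filter fun b => x.known b < x.label ∧
      Function.update x.flow w (x.flow w + δ) b < c v b).card
      + (if 0 < x.excess - δ then 1 else 0) + 1 ≤
      (Finset.univ.filter fun b => x.known b < x.label ∧ x.flow b < c v b).card
      + if 0 < x.excess then 1 else 0 := by
    rw [if_pos hpos]
    rcases min_choice x.excess (resCap c v x w) with h | h
    · rw [if_neg (by rw [hδ, h]; simp)]
      have := Finset.card_le_card hsub
      omega
    · have hss := Finset.card_lt_card (Finset.ssubset_iff_subset_ne.2 ⟨hsub, fun heq => by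
        have : w ∈ Finset.univ.filter fun b => x.known b < x.label ∧ x.flow b < c v b :=
          Finset.mem_filter.2 ⟨Finset.mem_univ _, hlabel, sub_pos.1 hw.2⟩
        rw [← heq, Finset.mem_filter, Function.update_self, hδ, h, resCap] at this
        linarith [this.2.2]⟩)
      have : (if 0 < x.excess - δ then 1 else 0) ≤ 1 := by split_ifs <;> simp
      omega
  simp only [localWt]
  nlinarith [Nat.mul_le_mul_right (4 * 4 ^ x.label) hcount]

theorem rank_emit_push {v w : Node V} {δ : ℝ} (L : ℕ) (hactive : Active v (C.node v))
    (hw : ResNbr c v (C.node v) w) (hlabel : (C.node v).known w < (C.node v).label)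
    (hδ : δ = min (C.node v).excess (resCap c v (C.node v) w)) :
    rank c L (C.emit v
      { C.node v with
        excess := (C.node v).excess - δ
        flow := Function.update (C.node v).flow w ((C.node v).flow w + δ)
        waiting := true }
      (sendTo w (.request δ (C.node v).label))) < rank c L C := by
  have hstalled : stalledWt (C.emit v
      { C.node v with
        excess := (C.node v).excess - δ
        flow := Function.update (C.node v).flow w ((C.node v).flow w + δ)
        waiting := true }
      (sendTo w (.request δ (C.node v).label))).node = stalledWt C.node := by
    apply stalledWt_congr
    intro a b
    rw [emit_node]
    split_ifs with h <;> simp [h]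
  apply rank_lt_of_potential_lt
  · exact Nat.add_right_cancel (nodeSum_emit _ C v _ _)
  · exact Nat.add_right_cancel (nodeSum_emit _ C v _ _)
  · rw [stalledCount, stalledCount, hstalled, msgSum_emit, sum_map_sendTo]
    simp [stalledWt, hlabel]
  · have h1 := nodeSum_emit (localWt c) C v
      { C.node v with
        excess := (C.node v).excess - δ
        flow := Function.update (C.node v).flow w ((C.node v).flow w + δ)
        waiting := true } (sendTo w (.request δ (C.node v).label))
    have h2 := localWt_push hactive.2.2 hw hlabel hδ
    have h3 : 0 < 4 ^ (C.node v).label := by positivity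
    rw [potential, potential, msgSum_emit, sum_map_sendTo]
    simp only [msgWt]
    dsimp only at h1
    omega

/-- The only arc that can reopen leads to `u`, which is not recorded as lower and hence not counted.
Only the activity term can grow. -/
theorem localWt_receive_le (v u : Node V) {x : LocalState V} {m : Msg}
    (hdown : ∀ b, (receive x u m).1.known b < x.label ↔ x.known b < x.label)
    (hu : m.taken x.label ≠ 0 → ¬ x.known u < x.label) :
    localWt c v (receive x u m).1 ≤ localWt c v x +
      if m.taken x.label = 0 then 0 else 4 * 4 ^ x.label := by
  have hset : (Finset.univ.filter fun w => (receive x u m).1.known w < x.label ∧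
      (receive x u m).1.flow w < c v w) =
      Finset.univ.filter fun w => x.known w < x.label ∧ x.flow w < c v w := by
    refine Finset.filter_congr fun b _ => ?_
    rw [hdown, receive_flow]
    by_cases hb : b = u
    · subst hb
      by_cases h0 : m.taken x.label = 0
      · simp [h0]
      · simp [hu h0]
    · simp [hb]
  simp only [localWt, receive_label, hset, receive_excess]
  by_cases h0 : m.taken x.label = 0
  · simp [h0]
  · rw [if_neg h0, ← Nat.succ_mul]
    refine Nat.mul_le_mul_right _ ?_
    split_ifs <;> omega

/-- A delivery changes no label and only raises recorded labels, so the first two components do not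
grow. A NAK may raise the potential by undoing a push; this is why `stalledCount` comes before it.
-/
theorem rank_deliver (hC : Inv c C) (L : ℕ) {u v : Node V} {m : Msg} {q : List Msg}
    (hq : C.chan u v = m :: q) : rank c L (C.deliver u v m q) < rank c L C := by
  have hm : m ∈ C.chan u v := by simp [hq]
  obtain ⟨k, hk, -⟩ := hq ▸ hC.sync u v (hC.nbr _ _ _ hm)
  have hself := receive_known_self _ _ hk
  have hroom : labelRoom L (C.deliver u v m q) = labelRoom L C := by
    have := nodeSum_deliver (fun _ x => L - x.label) C u v m q
    simp only [receive_label] at this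
    exact Nat.add_right_cancel this
  have hlower := nodeSum_deliver
    (fun _ x => (Finset.univ.filter fun w => x.known w < x.label).card) C u v m q
  simp only [receive_label] at hlower
  have hsub : (Finset.univ.filter fun w =>
      (receive (C.node v) u m).1.known w < (C.node v).label) ⊆
      Finset.univ.filter fun w => (C.node v).known w < (C.node v).label := by
    intro b
    simp only [Finset.mem_filter, Finset.mem_univ, true_and]
    by_cases hb : b = u
    · subst hb
      rw [hself]
      exact hk.le.trans_lt
    · rw [receive_known_of_ne _ _ hb]
      exact id
  -- Either some node ceases to be taken as lower and `lowerCount` falls, or all comparisons of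
  -- labels stay as they were.
  rcases hsub.eq_or_ssubset with hset | hss
  swap
  · have := Finset.card_lt_card hss
    exact rank_lt_of_lowerCount_lt hroom (by rw [lowerCount, lowerCount]; omega)
  have hdown : ∀ b, (receive (C.node v) u m).1.known b < (C.node v).label ↔
      (C.node v).known b < (C.node v).label := by
    intro b
    simpa using Finset.ext_iff.1 hset b
  have hlow : lowerCount (C.deliver u v m q) = lowerCount C := by
    rw [hset] at hlower
    exact Nat.add_right_cancel hlower
  have hstalled : stalledWt (C.deliver u v m q).node = stalledWt C.node := by
    apply stalledWt_congr
    intro a b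
    rw [emit_node]
    split_ifs with h
    · rw [receive_label, hdown, h]
    · rfl
  have hst := msgSum_deliver (stalledWt C.node) hq
  have hmsg := msgSum_deliver (fun _ _ => msgWt) hq
  have hloc := nodeSum_deliver (localWt c) C u v m q
  have hle := localWt_receive_le (c := c) v u (m := m) hdown
  cases m with
  | request δ d =>
    -- By the order of delivery, `v` already knows the label in the request. On acceptance `u` is
    -- therefore not recorded as lower, as `localWt_receive_le` demands.
    have hkd : (C.node v).known u = d := hk.1.symm
    by_cases hl : (C.node v).label < d
    · apply rank_lt_of_potential_lt hroom hlow
      · rw [stalledCount, stalledCount, hstalled]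
        simp only [receive, if_pos hl, sum_map_sendTo] at hst
        simp only [stalledWt] at hst
        omega
      · have hle := (hle fun _ => by omega).trans
          (Nat.add_le_add_left (m := 4 * 4 ^ (C.node v).label) (by split_ifs <;> simp) _)
        have hpow : 4 * 4 ^ (C.node v).label ≤ 4 ^ d := by
          rw [← pow_succ']
          exact Nat.pow_le_pow_right (by norm_num) hl
        have hone : 0 < 4 ^ d := by positivity
        have hout : ∑ b, (((receive (C.node v) u (.request δ d)).2 b).map msgWt).sum = 1 := by
          simp only [receive, if_pos hl]
          exact sum_map_sendTo (fun _ => msgWt) u _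
        rw [hout] at hmsg
        simp only [msgWt] at hmsg
        rw [potential, potential]
        omega
    · apply rank_lt_of_potential_lt hroom hlow
      · rw [stalledCount, stalledCount, hstalled]
        simp only [receive, if_neg hl, sum_map_sendTo] at hst
        exact (Nat.add_right_cancel hst).le
      · have hle := hle fun h => (h (by simp [Msg.taken, hl])).elim
        rw [if_pos (by simp [Msg.taken, hl])] at hle
        have hone : 0 < 4 ^ d := by positivity
        have hout : ∑ b, (((receive (C.node v) u (.request δ d)).2 b).map msgWt).sum = 1 := by
          simp only [receive, if_neg hl]
          exact sum_map_sendTo (fun _ => msgWt) u _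
        rw [hout] at hmsg
        simp only [msgWt] at hmsg
        rw [potential, potential]
        omega
  | nak δ d =>
    apply rank_lt_of_stalledCount_lt hroom hlow
    have hd := hC.nak_label _ _ _ _ hm
    -- After receipt `u` is not taken to be lower. As no comparison has changed, it was not before
    -- either, so the consumed NAK was counted as stalled.
    have hnot : ¬ (C.node v).known u < (C.node v).label := by
      rw [← hdown, hself, hk.2]
      omega
    rw [stalledCount, stalledCount, hstalled]
    simp only [receive, stalledWt, if_neg hnot, List.map_nil, List.sum_nil,
      Finset.sum_const_zero] at hst
    omega
  | _ =>
    apply rank_lt_of_potential_lt hroom hlow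
    · rw [stalledCount, stalledCount, hstalled]
      simp only [receive, List.map_nil, List.sum_nil, Finset.sum_const_zero] at hst
      omega
    · have hle := hle fun h => (h rfl).elim
      simp only [Msg.taken, if_true] at hle
      simp only [receive, msgWt, List.map_nil, List.sum_nil, Finset.sum_const_zero] at hmsg
      rw [potential, potential]
      omega

theorem rank_step (hC : Inv c C) {L : ℕ} {C' : Config V} (h : Step c C C')
    (hl : ∀ a, (C'.node a).label ≤ L) : rank c L C' < rank c L C := by
  cases h with
  | act v y out h =>
    cases h with
    | push w δ hactive hidle hw hlabel hδ => exact rank_emit_push L hactive hw hlabel hδ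
    | relabel k hactive hidle hmin hlabel =>
      apply rank_lt_of_labelRoom_lt
      have h1 := nodeSum_emit (fun _ x => L - x.label) C v { C.node v with label := k + 1 }
        (fun u => if Nbr c v u then [.newLabel (k + 1)] else [])
      have h2 := hl v
      simp only [emit_node, if_pos] at h2
      simp only [labelRoom]
      dsimp only at h1
      omega
  | deliver u v m q hq => exact rank_deliver hC L hq

theorem not_exists_infinite_execution (hc : ∀ a b, 0 ≤ c a b) (hirr : ∀ a, c a a = 0)
    (hC : Inv c C) (hl : ∀ a, (C.node a).label ≤ 2 * Fintype.card V + 3) :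
    ¬ ∃ σ : ℕ → Config V, σ 0 = C ∧ ∀ k, Step c (σ k) (σ (k + 1)) := by
  rintro ⟨σ, rfl, hσ⟩
  have hinv : ∀ k, Inv c (σ k) ∧ ∀ a, ((σ k).node a).label ≤ 2 * Fintype.card V + 3 := by
    intro k
    induction k with
    | zero => exact ⟨hC, hl⟩
    | succ k ih =>
      have := ih.1.step hc hirr (hσ k)
      exact ⟨this, this.label_le_step hc (hσ k) ih.2⟩
  obtain ⟨k, hk⟩ := WellFounded.has_min (wellFounded_lt (α := ℕ ×ₗ ℕ ×ₗ ℕ ×ₗ ℕ))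
    (Set.range fun k => rank c (2 * Fintype.card V + 3) (σ k)) ⟨_, 0, rfl⟩
  obtain ⟨⟨k, rfl⟩, hmin⟩ := hk
  exact hmin _ ⟨k + 1, rfl⟩ (rank_step (hinv k).1 (hσ k) (hinv (k + 1)).2)

end Termination

end HushRelay

/-! ### Weak duality of flows and cuts -/

/-- The value of a flow is at most the capacity of a cut. -/
theorem PCN.IsFlow.value_le_cut {V : Type*} [Fintype V] [DecidableEq V] {G : PCN V} {s r : V}
    {f : V → V → ℝ} (hf : G.IsFlow s r f) {A : Finset V} (hs : s ∈ A) (hr : r ∉ A) :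
    ∑ v, f v r ≤ ∑ a ∈ A, ∑ b ∈ Aᶜ, G.cap a b := by
  have h1 : ∑ b ∈ Aᶜ, ∑ u, f u b = ∑ v, f v r := by
    refine Finset.sum_eq_single_of_mem r (Finset.mem_compl.2 hr) fun b hb hbr =>
      hf.conservation b ?_ hbr
    rintro rfl
    exact Finset.mem_compl.1 hb hs
  have h2 : ∑ b ∈ Aᶜ, ∑ u ∈ Aᶜ, f u b = 0 := by
    have h : ∑ b ∈ Aᶜ, ∑ u ∈ Aᶜ, f u b = -∑ b ∈ Aᶜ, ∑ u ∈ Aᶜ, f u b := by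
      conv_lhs => rw [Finset.sum_comm]
      simp only [← Finset.sum_neg_distrib]
      exact Finset.sum_congr rfl fun u _ => Finset.sum_congr rfl fun b _ => hf.antisymm u b
    linarith
  have h3 : ∑ b ∈ Aᶜ, ∑ u, f u b = ∑ a ∈ A, ∑ b ∈ Aᶜ, f a b := by
    simp only [← Finset.sum_add_sum_compl A, Finset.sum_add_distrib, h2, add_zero]
    exact Finset.sum_comm
  rw [← h1, h3]
  exact Finset.sum_le_sum fun a _ => Finset.sum_le_sum fun b _ => hf.capacity a b

theorem PCN.maxFlow_le_cut {V : Type*} [Fintype V] [DecidableEq V] (G : PCN V) {s r : V}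
    {A : Finset V} (hs : s ∈ A) (hr : r ∉ A) :
    G.maxFlow s r ≤ ∑ a ∈ A, ∑ b ∈ Aᶜ, G.cap a b := by
  refine csSup_le (G.flowValues_nonempty s r) ?_
  rintro F ⟨f, hf, rfl⟩
  exact hf.value_le_cut hs hr

/-! ### Progress and correctness on termination -/

namespace HushRelay

section Correctness

variable {V : Type*} [DecidableEq V] [Fintype V] {c : Node V → Node V → ℝ} {C : Config V}

theorem Inv.exists_step_of_active (hc : ∀ a b, 0 ≤ c a b) (hC : Inv c C) {v : Node V}
    (hactive : Active v (C.node v)) (hidle : (C.node v).waiting = false) :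
    ∃ C', Step c C C' := by
  by_cases h : ∃ w, ResNbr c v (C.node v) w ∧ (C.node v).known w < (C.node v).label
  · obtain ⟨w, hw, hlabel⟩ := h
    exact ⟨_, .act C v _ _ (.push w _ hactive hidle hw hlabel rfl)⟩
  · push Not at h
    have hne : {d | ∃ w, ResNbr c v (C.node v) w ∧ (C.node v).known w = d}.Nonempty := by
      by_contra hemp
      -- Without residual arcs no flow value of `v` is negative, so its excess could not be
      -- positive.
      have hflow : ∀ w, 0 ≤ (C.node v).flow w := by
        intro w
        by_contra! hw
        have hlt := hw.trans_le (hc v w)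
        exact hemp ⟨_, w, ⟨hC.nbr_of_lt hc hlt, sub_pos.2 hlt⟩, rfl⟩
      have := Finset.sum_nonneg fun w (_ : w ∈ Finset.univ) => hflow w
      have := hC.excess_eq v
      have := hactive.2.2
      linarith
    have hmem := Nat.sInf_mem hne
    refine ⟨_, .act C v _ _ (.relabel _ hactive hidle ⟨hmem, fun d hd => Nat.sInf_le hd⟩ ?_)⟩
    obtain ⟨w, hw, hk⟩ := hmem
    exact hk ▸ h w hw

theorem Inv.terminated_of_stuck (hc : ∀ a b, 0 ≤ c a b) (hC : Inv c C)
    (h : ¬ ∃ C', Step c C C') : Terminated C := by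
  have hchan : ∀ a b, C.chan a b = [] := by
    intro a b
    rcases hq : C.chan a b with _ | ⟨m, q⟩
    · rfl
    · exact (h ⟨_, .deliver C a b m q hq⟩).elim
  intro v
  have hidle : (C.node v).waiting = false := by
    have := hC.pending v
    simpa [msgSum, hchan] using this
  exact ⟨fun hactive => h (hC.exists_step_of_active hc hactive hidle), hidle⟩

/-- Label announcements may still be under way, but they book nothing; any other message would make
some node wait. -/
theorem Inv.flow_antisymm (hC : Inv c C) (hT : Terminated C) (a b : Node V) :
    (C.node a).flow b = -(C.node b).flow a := by
  have hzero : ∀ a b, bookedSum (C.chan a b) = 0 := by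
    intro a b
    refine List.sum_eq_zero fun x hx => ?_
    obtain ⟨m, hm, rfl⟩ := List.mem_map.1 hx
    have h1 := hC.pendingWt_eq_zero (hT a).2 hm
    have h2 := hC.pendingWt_eq_zero (hT b).2 hm
    cases m <;> simp [pendingWt, Msg.booked] at h1 h2 ⊢
  have := hC.pair a b
  rw [hzero, hzero] at this
  linarith

/-- Either one of the two virtual edges crosses the cut and alone contributes `val`, or the cut
restricts to one of `G` between `s` and `r`, where weak duality applies. -/
theorem val_le_cut (G : PCN V) {s r : V} {val : ℝ} (hval : 0 ≤ val) (hmax : val ≤ G.maxFlow s r)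
    (S : Finset (Node V)) (hs : .dummySource ∈ S) (hr : .dummySink ∉ S) :
    val ≤ ∑ a ∈ S, ∑ b ∈ Sᶜ, augCap G s r val a b := by
  have hc := augCap_nonneg G s r hval
  have hterm : ∀ a ∈ S, ∀ b ∈ Sᶜ,
      augCap G s r val a b ≤ ∑ a ∈ S, ∑ b ∈ Sᶜ, augCap G s r val a b := fun a ha b hb =>
    (Finset.single_le_sum (fun b _ => hc a b) hb).trans
      (Finset.single_le_sum (f := fun a => ∑ b ∈ Sᶜ, augCap G s r val a b)
        (fun a _ => Finset.sum_nonneg fun b _ => hc a b) ha)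
  by_cases h1 : Node.account s ∈ S
  · by_cases h2 : Node.account r ∈ S
    · simpa [augCap] using hterm _ h2 _ (Finset.mem_compl.2 hr)
    · let φ : V ↪ Node V := ⟨Node.account, fun a b h => by cases h; rfl⟩
      let A : Finset V := Finset.univ.filter fun v => Node.account v ∈ S
      have hA : A.map φ ⊆ S := by
        intro a ha
        obtain ⟨v, hv, rfl⟩ := Finset.mem_map.1 ha
        exact (Finset.mem_filter.1 hv).2
      have hA' : Aᶜ.map φ ⊆ Sᶜ := by
        intro a ha
        obtain ⟨v, hv, rfl⟩ := Finset.mem_map.1 ha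
        rw [Finset.mem_compl] at hv ⊢
        exact fun h => hv (Finset.mem_filter.2 ⟨Finset.mem_univ v, h⟩)
      calc val ≤ ∑ a ∈ A, ∑ b ∈ Aᶜ, G.cap a b :=
            hmax.trans (G.maxFlow_le_cut (by simpa [A] using h1) (by simpa [A] using h2))
        _ = ∑ a ∈ A.map φ, ∑ b ∈ Aᶜ.map φ, augCap G s r val a b := by
            simp only [Finset.sum_map]
            rfl
        _ ≤ ∑ a ∈ A.map φ, ∑ b ∈ Sᶜ, augCap G s r val a b :=
            Finset.sum_le_sum fun a _ =>
              Finset.sum_le_sum_of_subset_of_nonneg hA' fun b _ _ => hc a b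
        _ ≤ ∑ a ∈ S, ∑ b ∈ Sᶜ, augCap G s r val a b :=
            Finset.sum_le_sum_of_subset_of_nonneg hA fun a _ _ =>
              Finset.sum_nonneg fun b _ => hc a b
  · simpa [augCap] using hterm _ hs _ (Finset.mem_compl.2 h1)

theorem Inv.excess_account (hC : Inv c C) (hT : Terminated C) (v : V) :
    (C.node (.account v)).excess = 0 :=
  le_antisymm (not_lt.1 fun h => (hT (.account v)).1 ⟨by simp, by simp, h⟩)
    (hC.excess_nonneg _ (by simp))

theorem Inv.sum_excess (hC : Inv c C) (hT : Terminated C) :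
    ∑ a, (C.node a).excess = 0 := by
  have h : ∑ a, (C.node a).excess = -∑ a, (C.node a).excess := by
    simp only [hC.excess_eq, Finset.sum_neg_distrib, neg_neg]
    conv_lhs => rw [Finset.sum_comm]
    simp only [← Finset.sum_neg_distrib]
    exact Finset.sum_congr rfl fun a _ => Finset.sum_congr rfl fun b _ =>
      (hC.flow_antisymm hT a b).symm
  linarith

section Routed

variable {G : PCN V} {s r : V} {val : ℝ}

theorem Inv.excess_dummySink_eq_flow (hval : 0 ≤ val) (hC : Inv (augCap G s r val) C)
    (hT : Terminated C) :
    (C.node .dummySink).excess = (C.node (.account r)).flow .dummySink := by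
  have hc := augCap_nonneg G s r hval
  have hzero : ∀ b, b ≠ .account r → (C.node .dummySink).flow b = 0 := by
    intro b hb
    refine hC.flow_eq_zero hc ?_
    rcases b with v | _ | _
    · have : v ≠ r := fun h => hb (by rw [h])
      simp [Nbr, augCap, this]
    · simp [Nbr, augCap]
    · simp [Nbr, augCap]
  rw [hC.excess_eq, Finset.sum_eq_single (.account r) (fun b _ hb => hzero b hb) (by simp),
    hC.flow_antisymm hT (.account r)]

theorem Inv.excess_dummySink (hval : 0 ≤ val) (hmax : val ≤ G.maxFlow s r)
    (hC : Inv (augCap G s r val) C) (hT : Terminated C) :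
    (C.node .dummySink).excess = val := by
  apply le_antisymm
  · rw [hC.excess_dummySink_eq_flow hval hT]
    simpa [augCap] using hC.capacity (.account r) .dummySink
  -- This gap lies in `1, ..., n + 1`, strictly between the labels `0` of `r'` and `n + 2` of `s'`.
  · obtain ⟨k, hk1, hk2, hk⟩ := exists_gap C 0
    have hs := hC.label_source
    have hr := hC.label_sink
    have hgap : ∀ b, (C.node b).label ≠ k := by
      rintro (v | _ | _)
      · exact hk v
      · omega
      · omega
    have hmem : Node.dummySource ∈ Finset.univ.filter (fun a => k < (C.node a).label) :=
      Finset.mem_filter.2 ⟨Finset.mem_univ _, by omega⟩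
    have hnot : Node.dummySink ∉ Finset.univ.filter (fun a => k < (C.node a).label) :=
      fun h => by have := (Finset.mem_filter.1 h).2; omega
    have h1 := hC.sum_excess_le _ (hC.closed_of_gap hgap)
    have h2 := val_le_cut G hval hmax _ hmem hnot
    -- All accounts have excess `0`, so the upper set contributes only the excess of `s'`; that of
    -- `r'` is its negative.
    rw [Finset.sum_eq_single_of_mem _ hmem] at h1
    · have h3 := hC.sum_excess hT
      rw [sum_node, Finset.sum_eq_zero fun v _ => hC.excess_account hT v] at h3
      linarith
    · rintro (v | _ | _) hb hne
      · exact hC.excess_account hT v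
      · exact (hne rfl).elim
      · exact (hnot hb).elim

/-- Conservation at the other accounts and the value at `r` both follow: only `s` and `r` exchange
flow with dummy nodes. -/
theorem Inv.sum_routedFlow (hC : Inv c C) (hT : Terminated C) (v : V) :
    ∑ u, routedFlow C u v =
      (C.node (.account v)).flow .dummySource + (C.node (.account v)).flow .dummySink := by
  have h := hC.excess_eq (.account v)
  rw [hC.excess_account hT, sum_node] at h
  have h' : ∑ u, routedFlow C u v = -∑ u, (C.node (.account v)).flow (.account u) := by
    rw [← Finset.sum_neg_distrib]
    exact Finset.sum_congr rfl fun u _ => hC.flow_antisymm hT _ _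
  linarith

theorem Inv.flow_dummySource (hval : 0 ≤ val) (hC : Inv (augCap G s r val) C) {v : V}
    (hv : v ≠ s) : (C.node (.account v)).flow .dummySource = 0 :=
  hC.flow_eq_zero (augCap_nonneg G s r hval) (by simp [Nbr, augCap, hv])

theorem Inv.flow_dummySink (hval : 0 ≤ val) (hC : Inv (augCap G s r val) C) {v : V}
    (hv : v ≠ r) : (C.node (.account v)).flow .dummySink = 0 :=
  hC.flow_eq_zero (augCap_nonneg G s r hval) (by simp [Nbr, augCap, hv])

theorem Reachable.inv (hval : 0 ≤ val) (h : Reachable G s r val C) :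
    Inv (augCap G s r val) C := by
  induction h with
  | refl => exact inv_init G s r hval
  | tail _ hstep ih => exact ih.step (augCap_nonneg G s r hval) (augCap_self G s r val) hstep

end Routed

end Correctness

end HushRelay

theorem lemma1 {V : Type*} [Fintype V] [DecidableEq V] (G : PCN V) (s r : V) (hsr : s ≠ r)
    (val : ℝ) (hval : 0 ≤ val) (hmax : val ≤ G.maxFlow s r) :
    -- every execution is finite
    (¬ ∃ σ : ℕ → HushRelay.Config V, σ 0 = HushRelay.init s val ∧
      ∀ k, HushRelay.Step (HushRelay.augCap G s r val) (σ k) (σ (k + 1))) ∧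
    -- an execution can only stop when the protocol has terminated
    (∀ C : HushRelay.Config V, HushRelay.Reachable G s r val C →
      (¬ ∃ C', HushRelay.Step (HushRelay.augCap G s r val) C C') → HushRelay.Terminated C) ∧
    -- on termination the whole payment has been routed along a feasible flow
    (∀ C : HushRelay.Config V, HushRelay.Reachable G s r val C → HushRelay.Terminated C →
      G.IsFlow s r (HushRelay.routedFlow C) ∧
      ∑ v, HushRelay.routedFlow C v r = val ∧
      (C.node .dummySink).excess = val) := by
  have hc := HushRelay.augCap_nonneg G s r hval
  refine ⟨?_, fun C hR hstuck => (hR.inv hval).terminated_of_stuck hc hstuck, fun C hR hT => ?_⟩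
  · refine HushRelay.not_exists_infinite_execution hc (HushRelay.augCap_self G s r val)
      (HushRelay.inv_init G s r hval) ?_
    rintro (v | _ | _) <;> simp only [HushRelay.init, HushRelay.initLabel] <;> omega
  · have hC := hR.inv hval
    have he := hC.excess_dummySink hval hmax hT
    refine ⟨⟨fun v w => hC.capacity _ _, fun v w => hC.flow_antisymm hT _ _, fun v hs hr => ?_⟩,
      ?_, he⟩
    · rw [hC.sum_routedFlow hT, hC.flow_dummySource hval hs, hC.flow_dummySink hval hr, add_zero]
    · rw [hC.sum_routedFlow hT, hC.flow_dummySource hval hsr.symm, zero_add,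
        ← hC.excess_dummySink_eq_flow hval hT, he]
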